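/- For a finite connected undirected multigraph $G$ with vertex set $V$ and a vertex $v$, let $L(G)\in\mathbb Z^{V\times V}$ be the Laplacian (off-diagonal entry $-\mathrm{wt}(x,y)$, where $\mathrm{wt}(x,y)$ is the number of edges joining $x$ and $y$; diagonal entry the number of non-loop edges at $x$), let $\tilde\Delta_v$ be $L(G)$ with the row and column of $v$ omitted, and let the sandpile group with distinguished vertex $v$ be $\mathcal S(G,v)=\mathbb Z^{V\setminus\{v\}}/\tilde\Delta_v\,\mathbb Z^{V\setminus\{v\}}$. Let $k\ge 1$ and let $\vec s=(s_1,\dots,s_k)$ be a vector of positive integers. The thick cycle $C_{\vec s}$ has vertices $v_1,\dots,v_k$ and $s_i$ parallel edges joining $v_i$ and $v_{i+1}$ for each $i$ (indices modulo $k$). The subdivided banana graph $B_{\vec s}$ consists of two nodes joined by $k$ internally disjoint paths, the $l$-th of which has exactly $s_l$ edges (that is, $k$ parallel edges, the $l$-th of them subdivided by $s_l-1$ new nodes). Corollary (subdivided banana graphs). For every vertex $v$ of $B_{\vec s}$ and every vertex $w$ of $C_{\vec s}$, \[ \mathcal S(B_{\vec s},v)\cong\mathcal S(C_{\vec s},w),\qquad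 |\mathcal S(C_{\vec s},w)|=\sum_{i=1}^{k}\prod_{j\ne i}s_j. \] Consequently, if $k\ge 2$ and $g_t=\gcd\bigl(s_{i_1}\cdots s_{i_t}\mid 1\le i_1<\cdots<i_t\le k\bigr)$ for $0\le t\le k-2$ (so $g_0=1$), then \[ \mathcal S(B_{\vec s},v)\cong \bigoplus_{t=1}^{k-2}\mathbb Z/\tfrac{g_t}{g_{t-1}}\mathbb Z\ \oplus\ \mathbb Z/\tfrac{|\mathcal S(C_{\vec s},w)|}{g_{k-2}}\mathbb Z . \] -/

import Mathlib

open scoped Graph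

namespace Sandpile

section Group

variable {α β : Type*}

/-- The number of edges joining the vertices `x` and `y` (for a multigraph with finitely many
edges). -/
noncomputable def wt (G : Graph α β) (x y : α) : ℕ :=
  {e : β | G.IsLink e x y}.ncard

/-- The number of edges having `x` as exactly one of their two ends. Loops are not counted: they
contribute nothing to the Laplacian, all of whose rows sum to zero. -/
noncomputable def degree (G : Graph α β) (x : α) : ℕ :=
  {e : β | G.IsNonloopAt e x}.ncard

open Classical in
/-- The Laplacian of a multigraph: degrees on the diagonal, and minus the number of joining edges
off the diagonal. -/
noncomputable def laplacian (G : Graph α β) : Matrix V(G) V(G) ℤ :=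
  Matrix.of fun x y => if x = y then (degree G x : ℤ) else -(wt G x y : ℤ)

/-- The Laplacian with the row and the column of the vertex `s` omitted. -/
noncomputable def reducedLaplacian (G : Graph α β) (s : V(G)) :
    Matrix {x : V(G) // x ≠ s} {x : V(G) // x ≠ s} ℤ :=
  (laplacian G).submatrix Subtype.val Subtype.val

open Classical in
/-- The sandpile group of a finite multigraph `G` with distinguished vertex `s`: the cokernel of
the reduced Laplacian acting on integer vectors indexed by the vertices other than `s`. -/
abbrev SandpileGroup [Fintype α] (G : Graph α β) (s : V(G)) : Type _ :=
  ({x : V(G) // x ≠ s} → ℤ) ⧸ LinearMap.range (reducedLaplacian G s).mulVecLin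

/-- The multigraph on all of `α`, with edge set all of `β`, in which the edge `e` joins `l e` and
`r e`. -/
def ofEnds (l r : β → α) : Graph α β where
  vertexSet := Set.univ
  IsLink e x y := s(l e, r e) = s(x, y)
  edgeSet := Set.univ
  isLink_symm := fun _ _ => ⟨fun _ _ h => h.trans Sym2.eq_swap⟩
  eq_or_eq_of_isLink_of_isLink := by
    intro e x y v w h h'
    have h2 : s(x, y) = s(v, w) := h.symm.trans h'
    rcases Sym2.eq_iff.1 h2 with h3 | h3
    · exact Or.inl h3.1
    · exact Or.inr h3.1
  edge_mem_iff_exists_isLink := fun e => ⟨fun _ => ⟨l e, r e, rfl⟩, fun _ => Set.mem_univ e⟩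
  left_mem_of_isLink := fun _ x _ _ => Set.mem_univ x

end Group

/-- The thick cycle with multiplicity vector `a`: its vertices are `0, …, k - 1`, and for every `i`
there are `a i` parallel edges joining `i` and `i + 1`, where indices are read modulo `k`. -/
def thickCycle {k : ℕ} [NeZero k] (a : Fin k → ℕ) : Graph (Fin k) (Σ i : Fin k, Fin (a i)) :=
  ofEnds (fun e => e.1) (fun e => e.1 + 1)

/-- The vertices of the subdivided banana graph: the two poles `Sum.inl false` and `Sum.inl true`,
and `s l - 1` subdividing nodes on the `l`-th path. -/
abbrev BananaVertex {k : ℕ} (s : Fin k → ℕ) : Type :=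
  Bool ⊕ (Σ l : Fin k, Fin (s l - 1))

/-- The `j`-th node of the `l`-th path of the subdivided banana graph. It is the first pole for
`j = 0`, the second pole for `j = s l`, and a subdividing node for `0 < j < s l`. -/
def bananaNode {k : ℕ} (s : Fin k → ℕ) (l : Fin k) (j : ℕ) : BananaVertex s :=
  if h0 : j = 0 then Sum.inl false
  else if h : j < s l then Sum.inr ⟨l, ⟨j - 1, by omega⟩⟩
  else Sum.inl true

/-- The subdivided banana graph `B_s`: two poles joined by `k` internally disjoint paths, the `l`-th
of which has `s l` edges (that is, `k` parallel edges, the `l`-th of them subdivided by `s l - 1`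
new nodes). The `j`-th edge of the `l`-th path joins its `j`-th and its `(j + 1)`-st node. -/
def subdividedBanana {k : ℕ} (s : Fin k → ℕ) :
    Graph (BananaVertex s) (Σ l : Fin k, Fin (s l)) :=
  ofEnds (fun e => bananaNode s e.1 e.2) (fun e => bananaNode s e.1 (e.2 + 1))

/-- The greatest common divisor of the products `a i₁ * ⋯ * a iₜ` over `i₁ < ⋯ < iₜ`; it is `1`
for `t = 0`. -/
def gcdProd {k : ℕ} (a : Fin k → ℕ) (t : ℕ) : ℕ :=
  (Finset.powersetCard t (Finset.univ : Finset (Fin k))).gcd fun I => ∏ i ∈ I, a i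

end Sandpile

/-! Both sandpile groups have the same presentation: generators `e i` of sum zero, with all
multiples `s i • e i` equal (`ProportionalGroup s`). The sandpile group at `v` is universal for
harmonic functions vanishing at `v`, so only increments of harmonic functions matter and the choice
of `v` does not. On the thick cycle `e i` is the increment from vertex `i` to `i + 1`: going once
around gives sum zero, and harmonicity gives equal flows `s i • e i`. On the banana graph the roles
are exchanged: harmonicity at a subdividing node makes the increment `e l` constant along path `l`,
all `s l • e l` equal the difference of the poles, and harmonicity at a pole gives sum zero.

The order is the determinant of a square relation matrix. For the decomposition, source and target
have equal order, so it suffices to work one prime `p` at a time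
(`nonempty_addEquiv_of_forall_prime`). Sort `s` by `p`-adic valuation, as `r 0, …, r (n + 1)` with
`k = n + 2`; the valuation of `gcdProd s (t + 1) / gcdProd s t` is that of `r t`. Locally at `p` the
sum relation eliminates `e (n + 1)`, the elements `e t - (r n / r t) • e n` for `t < n` split off
cyclic summands of order `r t`, and `e n` generates the remaining one. In the code a factor `u`
prime to `p` clears the denominators. -/

namespace Sandpile

/-! ### The common presentation and its order. -/

section ProportionalGroup

variable {k : ℕ}

/-- The relations `∑ i, e i = 0` and `s i • e i = s j • e j` between the standard generators
of `ℤ ^ k`. -/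
def proportionalRelations (s : Fin k → ℕ) : Submodule ℤ (Fin k → ℤ) :=
  Submodule.span ℤ (insert 1 (Set.range fun p : Fin k × Fin k =>
    Pi.single p.1 (s p.1 : ℤ) - Pi.single p.2 (s p.2 : ℤ)))

/-- The abelian group on generators `e i` of sum zero, all of whose multiples `s i • e i` agree. -/
abbrev ProportionalGroup (s : Fin k → ℕ) : Type :=
  (Fin k → ℤ) ⧸ proportionalRelations s

namespace ProportionalGroup

/-- The generators of the group `ProportionalGroup s`. -/
def gen (s : Fin k → ℕ) (i : Fin k) : ProportionalGroup s :=
  Submodule.Quotient.mk (Pi.single i 1)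

theorem smul_gen (s : Fin k → ℕ) (i j : Fin k) : s i • gen s i = s j • gen s j := by
  rw [← sub_eq_zero]
  have h : s i • gen s i - s j • gen s j =
      Submodule.Quotient.mk (Pi.single i (s i : ℤ) - Pi.single j (s j : ℤ)) := by
    simp only [gen, ← Submodule.Quotient.mk_smul, ← Submodule.Quotient.mk_sub, ← Pi.single_smul]
    simp
  rw [h, Submodule.Quotient.mk_eq_zero]
  exact Submodule.subset_span (Set.mem_insert_of_mem _ ⟨(i, j), rfl⟩)

theorem sum_gen (s : Fin k → ℕ) : ∑ i, gen s i = 0 := by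
  have h : ∑ i, gen s i = (proportionalRelations s).mkQ (∑ i, Pi.single i 1) := by
    rw [map_sum]; rfl
  rw [h, Submodule.mkQ_apply, Submodule.Quotient.mk_eq_zero]
  refine Submodule.subset_span (Set.mem_insert_iff.2 (Or.inl ?_))
  exact Finset.univ_sum_single (1 : Fin k → ℤ)

theorem exists_lift {s : Fin k → ℕ} {M : Type*} [AddCommGroup M] (f : Fin k → M) (x : M)
    (hx : ∀ i, s i • f i = x) (hf : ∑ i, f i = 0) :
    ∃ φ : ProportionalGroup s →+ M, ∀ i, φ (gen s i) = f i := by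
  have hle : proportionalRelations s ≤ LinearMap.ker (Fintype.linearCombination ℤ f) := by
    refine Submodule.span_le.2 ?_
    rintro _ (rfl | ⟨p, rfl⟩)
    · simpa [Fintype.linearCombination_apply] using hf
    · simp [Fintype.linearCombination_apply_single, hx]
  refine ⟨((proportionalRelations s).liftQ _ hle).toAddMonoidHom, fun i => ?_⟩
  change Fintype.linearCombination ℤ f (Pi.single i 1) = f i
  rw [Fintype.linearCombination_apply_single, one_smul]

theorem closure_range_gen (s : Fin k → ℕ) : AddSubgroup.closure (Set.range (gen s)) = ⊤ := by
  refine eq_top_iff.2 fun a _ => ?_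
  obtain ⟨c, rfl⟩ := Submodule.Quotient.mk_surjective _ a
  have h : (Submodule.Quotient.mk c : ProportionalGroup s) = ∑ i, c i • gen s i := by
    conv_lhs => rw [← Finset.univ_sum_single c]
    rw [← Submodule.mkQ_apply, map_sum]
    refine Finset.sum_congr rfl fun i _ => ?_
    rw [gen, ← Submodule.Quotient.mk_smul, ← Pi.single_smul]
    simp
  rw [h]
  exact AddSubgroup.sum_mem _ fun i _ =>
    AddSubgroup.zsmul_mem _ (AddSubgroup.subset_closure (Set.mem_range_self i)) _

/-- The square matrix whose rows are the relation `∑ i, e i = 0` and the relations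
`s i • e i = s 0 • e 0` for `i ≠ 0`. -/
def relationMatrix [NeZero k] (s : Fin k → ℕ) : Matrix (Fin k) (Fin k) ℤ :=
  Matrix.of fun i => if i = 0 then 1 else Pi.single i (s i : ℤ) - Pi.single 0 (s 0 : ℤ)

theorem relationMatrix_zero [NeZero k] (s : Fin k → ℕ) : relationMatrix s 0 = 1 := by
  ext j
  simp [relationMatrix]

theorem relationMatrix_of_ne [NeZero k] (s : Fin k → ℕ) {i : Fin k} (hi : i ≠ 0) :
    relationMatrix s i = Pi.single i (s i : ℤ) - Pi.single 0 (s 0 : ℤ) :=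
  if_neg hi

/-- The relation for a pair `(i, j)` is the difference of those for `(i, 0)` and `(j, 0)`, so `k`
relations suffice and the order becomes a determinant. -/
theorem span_range_relationMatrix [NeZero k] (s : Fin k → ℕ) :
    Submodule.span ℤ (Set.range (relationMatrix s)) = proportionalRelations s := by
  apply le_antisymm
  · refine Submodule.span_le.2 ?_
    rintro _ ⟨i, rfl⟩
    apply Submodule.subset_span
    by_cases hi : i = 0
    · exact Or.inl (by rw [hi, relationMatrix_zero])
    · exact Or.inr ⟨(i, 0), (relationMatrix_of_ne s hi).symm⟩
  · have key : ∀ i, Pi.single i (s i : ℤ) - Pi.single 0 (s 0 : ℤ) ∈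
        Submodule.span ℤ (Set.range (relationMatrix s)) := by
      intro i
      by_cases hi : i = 0
      · subst hi; rw [sub_self]; exact Submodule.zero_mem _
      · exact Submodule.subset_span ⟨i, relationMatrix_of_ne s hi⟩
    refine Submodule.span_le.2 ?_
    rintro _ (rfl | ⟨p, rfl⟩)
    · exact Submodule.subset_span ⟨0, relationMatrix_zero s⟩
    · simpa using Submodule.sub_mem _ (key p.1) (key p.2)

theorem det_relationMatrix [NeZero k] (s : Fin k → ℕ) (hs : ∀ i, 1 ≤ s i) :
    (relationMatrix s).det = ((∑ i, ∏ j ∈ Finset.univ.erase i, s j : ℕ) : ℤ) := by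
  -- Since `s i * v i` is independent of `i`, every row but the first kills `v`. Replacing column
  -- `0` by the matrix applied to `v` makes the matrix upper triangular, at the cost of the factor
  -- `v 0 ≠ 0`.
  set v : Fin k → ℤ := fun i => ∏ j ∈ Finset.univ.erase i, (s j : ℤ) with hv
  have hv0 : v 0 ≠ 0 := Finset.prod_ne_zero_iff.2 fun j _ => by
    have := hs j
    positivity
  have hsv : ∀ i, (s i : ℤ) * v i = ∏ j, (s j : ℤ) := fun i =>
    Finset.mul_prod_erase _ (fun j => (s j : ℤ)) (Finset.mem_univ i)
  set C : Matrix (Fin k) (Fin k) ℤ := (1 : Matrix (Fin k) (Fin k) ℤ).updateCol 0 v with hC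
  have hCdet : C.det = v 0 := by
    rw [Matrix.det_of_isLowerTriangular, Finset.prod_eq_single 0]
    · simp [hC]
    · intro i _ hi; simp [hC, hi]
    · simp
    · intro i j hij
      have hij : i < j := hij
      have hj : j ≠ 0 := by rintro rfl; exact absurd hij (by simp)
      simp [hC, Matrix.updateCol_ne hj, Matrix.one_apply_ne hij.ne]
  have hMC : relationMatrix s * C = (relationMatrix s).updateCol 0 (Pi.single 0 (∑ i, v i)) := by
    ext i j
    by_cases hj : j = 0
    · subst hj
      rw [Matrix.mul_apply, Matrix.updateCol_self]
      by_cases hi : i = 0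
      · subst hi; simp [hC, relationMatrix]
      · simp [hC, relationMatrix, hi, Pi.single_apply, sub_mul, Finset.sum_sub_distrib, hsv]
    · rw [Matrix.mul_apply, Matrix.updateCol_ne hj]
      simp [hC, Matrix.updateCol_ne hj, Matrix.one_apply]
  have hMCdet : (relationMatrix s * C).det = (∑ i, v i) * v 0 := by
    rw [hMC, Matrix.det_of_isUpperTriangular,
      ← Finset.mul_prod_erase _ _ (Finset.mem_univ (0 : Fin k))]
    · refine congrArg₂ (· * ·) (by simp) (Finset.prod_congr rfl fun i hi => ?_)
      have hi : i ≠ 0 := Finset.ne_of_mem_erase hi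
      simp [relationMatrix, hi]
    · intro i j hij
      have hij : j < i := hij
      have hi : i ≠ 0 := by rintro rfl; exact absurd hij (by simp)
      by_cases hj : j = 0
      · subst hj; simp [hi]
      · simp [relationMatrix, hi, hj, hij.ne]
  rw [Matrix.det_mul, hCdet] at hMCdet
  rw [mul_right_cancel₀ hv0 hMCdet]
  simp [hv]

theorem natCard [NeZero k] (s : Fin k → ℕ) (hs : ∀ i, 1 ≤ s i) :
    Nat.card (ProportionalGroup s) = ∑ i, ∏ j ∈ Finset.univ.erase i, s j := by
  have hdet := det_relationMatrix s hs
  have hpos : 0 < ∑ i, ∏ j ∈ Finset.univ.erase i, s j :=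
    Finset.sum_pos (fun i _ => Finset.prod_pos fun j _ => hs j) Finset.univ_nonempty
  have hli : LinearIndependent ℤ (relationMatrix s) :=
    Matrix.linearIndependent_rows_of_det_ne_zero (by rw [hdet]; exact_mod_cast hpos.ne')
  have h := Submodule.natAbs_det_basis_change (Pi.basisFun ℤ (Fin k)) _ (Module.Basis.span hli)
  have h2 : (Subtype.val ∘ (Module.Basis.span hli) : Fin k → Fin k → ℤ) = relationMatrix s := by
    ext1 i
    exact congrArg Subtype.val (Module.Basis.span_apply hli i)
  rw [h2, span_range_relationMatrix, Pi.basisFun_det] at h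
  rw [← h]
  change ((relationMatrix s).det).natAbs = _
  rw [hdet, Int.natAbs_natCast]

end ProportionalGroup

end ProportionalGroup

/-! ### Gluing homomorphisms over the primes. -/

section LocalGlobal

/-- Two finite abelian groups of the same order are isomorphic if, for every prime `p`, there is a
homomorphism from the first to the second whose cokernel is killed by a number prime to `p`. -/
theorem nonempty_addEquiv_of_forall_prime {A B : Type*} [AddCommGroup A] [AddCommGroup B]
    [Finite A] [Finite B] (hcard : Nat.card A = Nat.card B)
    (h : ∀ p : ℕ, p.Prime → ∃ (f : A →+ B) (u : ℕ), p.Coprime u ∧ ∀ b, u • b ∈ f.range) :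
    Nonempty (A ≃+ B) := by
  choose! f u hu hf using h
  set N := Nat.card B with hN
  have hN0 : N ≠ 0 := Nat.card_pos.ne'
  -- Modulo `p` only the term `q = p` survives, because `p` divides `ordCompl[q] N` for every other
  -- `q`.
  set F : A →+ B := ∑ q ∈ N.primeFactors, (ordCompl[q] N) • f q with hF
  have hsurj : Function.Surjective F := by
    rw [← AddMonoidHom.range_eq_top]
    by_contra hne
    have hcard1 : Nat.card (B ⧸ F.range) ≠ 1 := fun h1 =>
      hne (AddSubgroup.index_eq_one.1 h1)
    obtain ⟨p, hp, hpd⟩ := Nat.exists_prime_and_dvd hcard1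
    have hpN : p ∈ N.primeFactors :=
      Nat.mem_primeFactors.2 ⟨hp, hpd.trans (AddSubgroup.index_dvd_card F.range), hN0⟩
    -- Multiplication by `p` on the finite cokernel would be onto, hence injective, contradicting
    -- the element of order `p` given by Cauchy's theorem.
    have hmulsurj : Function.Surjective fun c : B ⧸ F.range => p • c := by
      intro c
      obtain ⟨b, rfl⟩ := QuotientAddGroup.mk_surjective c
      have hcop : Nat.Coprime p (ordCompl[p] N * u p) :=
        (Nat.coprime_ordCompl hp hN0).mul_right (hu p hp)
      obtain ⟨a, ha⟩ := hf p hp b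
      have hFa : ∃ b' : B, F a = (ordCompl[p] N * u p) • b + p • b' := by
        have hrest : ∀ q ∈ N.primeFactors.erase p, ∃ b' : B, ordCompl[q] N • f q a = p • b' := by
          intro q hq
          have hqp : q ≠ p := Finset.ne_of_mem_erase hq
          have hqprime := Nat.prime_of_mem_primeFactors (Finset.mem_of_mem_erase hq)
          have hd : p ∣ ordCompl[q] N := Nat.dvd_ordCompl_of_dvd_not_dvd
            (Nat.dvd_of_mem_primeFactors hpN)
            fun hd => hqp ((Nat.prime_dvd_prime_iff_eq hqprime hp).1 hd)
          obtain ⟨c, hc⟩ := hd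
          exact ⟨c • f q a, by rw [hc, mul_smul]⟩
        choose! g hg using hrest
        refine ⟨∑ q ∈ N.primeFactors.erase p, g q, ?_⟩
        rw [hF, AddMonoidHom.finsetSum_apply, ← Finset.add_sum_erase _ _ hpN, Finset.smul_sum,
          AddMonoidHom.smul_apply, ha, ← mul_smul]
        congr 1
        exact Finset.sum_congr rfl hg
      obtain ⟨b', hb'⟩ := hFa
      obtain ⟨x, y, hxy⟩ := Nat.isCoprime_iff_coprime.2 hcop
      have hb : (((ordCompl[p] N * u p) • b + p • b' : B) : B ⧸ F.range) = 0 := by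
        rw [← hb', QuotientAddGroup.eq_zero_iff]
        exact ⟨a, rfl⟩
      rw [QuotientAddGroup.mk_add, QuotientAddGroup.mk_nsmul, QuotientAddGroup.mk_nsmul] at hb
      refine ⟨x • (b : B ⧸ F.range) - y • (b' : B ⧸ F.range), ?_⟩
      have h1 : (b : B ⧸ F.range) = (x * p + y * (ordCompl[p] N * u p : ℕ)) • (b : B ⧸ F.range) := by
        rw [hxy, one_smul]
      have h2 := congrArg (fun c => y • c) hb
      simp only [smul_add, smul_zero] at h2
      simp only [← natCast_zsmul] at h2 ⊢
      conv_rhs => rw [h1]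
      rw [← sub_eq_zero] at h2 ⊢
      rw [← neg_eq_zero, ← h2]
      module
    have hinj := Finite.injective_iff_surjective.2 hmulsurj
    have := Fact.mk hp
    obtain ⟨c, hc⟩ := exists_prime_addOrderOf_dvd_card' p hpd
    have hc0 : c = 0 := hinj (by
      change p • c = p • 0
      rw [smul_zero, ← hc, addOrderOf_nsmul_eq_zero])
    rw [hc0, addOrderOf_zero] at hc
    exact hp.one_lt.ne hc
  exact ⟨AddEquiv.ofBijective F ((Nat.bijective_iff_surjective_and_card F).2 ⟨hsurj, hcard⟩)⟩

end LocalGlobal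

/-! ### Harmonic functions and the universal property of the sandpile group. -/

section OfEnds

variable {α β : Type*} (l r : β → α)

open Classical in
/-- The signed incidence of the edge `e`, directed from `l e` to `r e`, with the vertex `x`. -/
noncomputable def incidence (e : β) (x : α) : ℤ :=
  (if l e = x then 1 else 0) - (if r e = x then 1 else 0)

theorem isLink_ofEnds {e : β} {x y : α} :
    (ofEnds l r).IsLink e x y ↔ (l e = x ∧ r e = y) ∨ (l e = y ∧ r e = x) :=
  Sym2.eq_iff

theorem isNonloopAt_ofEnds {e : β} {x : α} :
    (ofEnds l r).IsNonloopAt e x ↔ (l e = x ∧ r e ≠ x) ∨ (r e = x ∧ l e ≠ x) := by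
  simp only [Graph.IsNonloopAt, isLink_ofEnds]
  constructor
  · rintro ⟨y, hy, ⟨h1, h2⟩ | ⟨h1, h2⟩⟩
    · exact Or.inl ⟨h1, h2 ▸ hy⟩
    · exact Or.inr ⟨h2, h1 ▸ hy⟩
  · rintro (⟨h1, h2⟩ | ⟨h1, h2⟩)
    · exact ⟨r e, h2, Or.inl ⟨h1, rfl⟩⟩
    · exact ⟨l e, h2, Or.inr ⟨rfl, h1⟩⟩

open Classical in
theorem natCast_ncard_setOf [Fintype β] (p : β → Prop) :
    (({e | p e}.ncard : ℕ) : ℤ) = ∑ e, if p e then 1 else 0 := by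
  rw [Set.ncard_eq_toFinset_card', Finset.sum_boole, Set.toFinset_ofPred]

/-- The Laplacian is the Gram matrix of the signed incidence matrix; a loop has zero incidence,
which covers the one-vertex thick cycle. -/
theorem laplacian_ofEnds [Fintype β] (x y : V(ofEnds l r)) :
    laplacian (ofEnds l r) x y = ∑ e, incidence l r e x * incidence l r e y := by
  classical
  by_cases hxy : x = y
  · subst hxy
    simp only [laplacian, Matrix.of_apply, if_true, degree, natCast_ncard_setOf,
      isNonloopAt_ofEnds]
    refine Finset.sum_congr rfl fun e _ => ?_
    by_cases h1 : l e = x <;> by_cases h2 : r e = x <;> simp [incidence, h1, h2]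
  · have hxy' : (x : α) ≠ y := fun h => hxy (Subtype.ext h)
    simp only [laplacian, Matrix.of_apply, if_neg hxy, wt, natCast_ncard_setOf, isLink_ofEnds,
      ← Finset.sum_neg_distrib]
    refine Finset.sum_congr rfl fun e _ => ?_
    by_cases h1 : l e = x <;> by_cases h2 : r e = x <;> by_cases h3 : l e = y <;>
      by_cases h4 : r e = y <;> simp_all [incidence]

/-- A function on the vertices with values in an abelian group is harmonic if the sum of its
increments along the edges leaving a vertex vanishes, at every vertex. -/
def IsHarmonic [Fintype β] {M : Type*} [AddCommGroup M] (h : α → M) : Prop :=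
  ∀ x, ∑ e, incidence l r e x • (h (l e) - h (r e)) = 0

theorem sum_incidence_smul [Fintype α] {M : Type*} [AddCommGroup M] (h : α → M) (e : β) :
    ∑ x, incidence l r e x • h x = h (l e) - h (r e) := by
  classical
  simp [incidence, sub_smul, Finset.sum_sub_distrib]

variable {l r}

theorem sum_ne_eq_sum [Fintype α] {M : Type*} [AddCommGroup M] (v : V(ofEnds l r))
    [Fintype {x : V(ofEnds l r) // x ≠ v}] (g : α → M) (hg : g v = 0) :
    ∑ y : {x : V(ofEnds l r) // x ≠ v}, g y.1 = ∑ y, g y := by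
  refine Finset.sum_of_injOn (fun y => (y.1 : α)) ?_ ?_ ?_ ?_
  · intro a _ b _ hab
    exact Subtype.ext (Subtype.ext hab)
  · intro a _
    simp
  · intro a _ ha
    by_cases hav : a = v
    · rw [hav, hg]
    · exact absurd ⟨⟨⟨a, Set.mem_univ a⟩, fun h => hav (congrArg Subtype.val h)⟩,
        by simp, rfl⟩ ha
  · intro a _
    rfl

namespace SandpileGroup

open Classical in
/-- The indicator of a vertex, as an integer vector indexed by the vertices other than `v`. -/
noncomputable def indicator (v : V(ofEnds l r)) (x : α) : {x : V(ofEnds l r) // x ≠ v} → ℤ :=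
  fun y => if x = y.1 then 1 else 0

theorem sum_incidence_smul_indicator [Fintype β] (v : V(ofEnds l r)) (x : α)
    (y : {x : V(ofEnds l r) // x ≠ v}) :
    (∑ e, incidence l r e x • (indicator v (l e) - indicator v (r e))) y =
      laplacian (ofEnds l r) y.1 ⟨x, Set.mem_univ x⟩ := by
  rw [laplacian_ofEnds, Finset.sum_apply]
  refine Finset.sum_congr rfl fun e _ => ?_
  simp only [incidence, indicator, Pi.smul_apply, Pi.sub_apply, smul_eq_mul]
  ring

variable [Fintype α]

/-- The class of a vertex in the sandpile group. -/
noncomputable def vertexClass (v : V(ofEnds l r)) (x : α) : SandpileGroup (ofEnds l r) v :=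
  Submodule.Quotient.mk (indicator v x)

theorem vertexClass_self (v : V(ofEnds l r)) : vertexClass v v = 0 := by
  have h : indicator v v = 0 := by
    ext y
    exact if_neg fun h => y.2 (Subtype.ext h.symm)
  rw [vertexClass, h, Submodule.Quotient.mk_zero]

theorem closure_range_vertexClass (v : V(ofEnds l r)) :
    AddSubgroup.closure (Set.range (vertexClass v)) = ⊤ := by
  classical
  refine eq_top_iff.2 fun a _ => ?_
  obtain ⟨c, rfl⟩ := Submodule.Quotient.mk_surjective _ a
  have h : (Submodule.Quotient.mk c : SandpileGroup (ofEnds l r) v) =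
      ∑ y, c y • vertexClass v (y.1 : α) := by
    conv_lhs => rw [← Finset.univ_sum_single c]
    rw [← Submodule.mkQ_apply, map_sum]
    refine Finset.sum_congr rfl fun y _ => ?_
    rw [vertexClass, ← Submodule.Quotient.mk_smul, Submodule.mkQ_apply]
    congr 1
    ext z
    simp [indicator, Pi.single_apply, Subtype.ext_iff, eq_comm]
  rw [h]
  exact AddSubgroup.sum_mem _ fun y _ =>
    AddSubgroup.zsmul_mem _ (AddSubgroup.subset_closure (Set.mem_range_self _)) _

variable [Fintype β]

theorem isHarmonic_vertexClass (v : V(ofEnds l r)) : IsHarmonic l r (vertexClass v) := by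
  classical
  have key : ∀ x : α, x ≠ v →
      ∑ e, incidence l r e x • (vertexClass v (l e) - vertexClass v (r e)) = 0 := by
    intro x hx
    have h : ∑ e, incidence l r e x • (vertexClass v (l e) - vertexClass v (r e)) =
        (LinearMap.range (reducedLaplacian (ofEnds l r) v).mulVecLin).mkQ
          (∑ e, incidence l r e x • (indicator v (l e) - indicator v (r e))) := by
      rw [map_sum]; rfl
    rw [h, Submodule.mkQ_apply, Submodule.Quotient.mk_eq_zero]
    refine ⟨Pi.single ⟨⟨x, Set.mem_univ x⟩, fun h => hx (congrArg Subtype.val h)⟩ 1, ?_⟩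
    ext y
    rw [sum_incidence_smul_indicator]
    simp [reducedLaplacian]
  intro x
  by_cases hx : x = v
  -- The omitted row is redundant: each edge has total incidence zero, so harmonicity elsewhere
  -- forces it at `v`.
  · have htot : ∑ y, ∑ e, incidence l r e y • (vertexClass v (l e) - vertexClass v (r e)) = 0 := by
      rw [Finset.sum_comm]
      refine Finset.sum_eq_zero fun e _ => ?_
      rw [sum_incidence_smul l r (fun _ => vertexClass v (l e) - vertexClass v (r e)), sub_self]
    rwa [Finset.sum_eq_single x (fun y _ hy => key y (hx ▸ hy)) (by simp)] at htot
  · exact key x hx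

theorem exists_lift {M : Type*} [AddCommGroup M] (v : V(ofEnds l r)) (f : α → M)
    (hf : IsHarmonic l r f) (hv : f v = 0) :
    ∃ φ : SandpileGroup (ofEnds l r) v →+ M, ∀ x, φ (vertexClass v x) = f x := by
  classical
  set F : ({x : V(ofEnds l r) // x ≠ v} → ℤ) →ₗ[ℤ] M :=
    Fintype.linearCombination ℤ (fun y => f y.1) with hF
  have hle : LinearMap.range (reducedLaplacian (ofEnds l r) v).mulVecLin ≤ LinearMap.ker F := by
    rw [Matrix.range_mulVecLin, Submodule.span_le]
    rintro _ ⟨z, rfl⟩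
    have h1 : F ((reducedLaplacian (ofEnds l r) v).col z) =
        ∑ y : {x : V(ofEnds l r) // x ≠ v},
          (∑ e, incidence l r e y.1 * incidence l r e z.1) • f y.1 := by
      rw [hF, Fintype.linearCombination_apply]
      refine Finset.sum_congr rfl fun y _ => ?_
      rw [← laplacian_ofEnds]
      rfl
    rw [SetLike.mem_coe, LinearMap.mem_ker, h1,
      sum_ne_eq_sum v (fun y => (∑ e, incidence l r e y * incidence l r e z.1) • f y)
        (by rw [hv, smul_zero])]
    simp only [Finset.sum_smul]
    rw [Finset.sum_comm, ← hf z.1]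
    refine Finset.sum_congr rfl fun e _ => ?_
    rw [← sum_incidence_smul, Finset.smul_sum]
    refine Finset.sum_congr rfl fun y _ => ?_
    rw [mul_comm, mul_smul]
  refine ⟨(Submodule.liftQ _ F hle).toAddMonoidHom, fun x => ?_⟩
  change F (indicator v x) = f x
  rw [hF, Fintype.linearCombination_apply]
  refine (sum_ne_eq_sum v (fun y => (if x = y then (1 : ℤ) else 0) • f y)
    (by rw [hv, smul_zero])).trans ?_
  simp

/-- A group generated by the increments of a harmonic function is isomorphic to the sandpile group
as soon as it maps to it compatibly with the vertices. -/
theorem nonempty_addEquiv (v : V(ofEnds l r)) {A : Type*} [AddCommGroup A] (h : α → A)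
    (hh : IsHarmonic l r h)
    (hgen : AddSubgroup.closure (Set.range fun p : α × α => h p.1 - h p.2) = ⊤)
    (ψ : A →+ SandpileGroup (ofEnds l r) v)
    (hψ : ∀ x y, ψ (h x - h y) = vertexClass v x - vertexClass v y) :
    Nonempty (SandpileGroup (ofEnds l r) v ≃+ A) := by
  obtain ⟨φ, hφ⟩ := exists_lift v (fun x => h x - h v)
    (fun x => by simpa only [sub_sub_sub_cancel_right] using hh x) (sub_self _)
  have h1 : ψ.comp φ = AddMonoidHom.id _ := by
    refine AddMonoidHom.eq_of_eqOn_dense (closure_range_vertexClass v) ?_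
    rintro _ ⟨x, rfl⟩
    simp only [AddMonoidHom.comp_apply, hφ, hψ, vertexClass_self, sub_zero, AddMonoidHom.id_apply]
  have h2 : φ.comp ψ = AddMonoidHom.id _ := by
    refine AddMonoidHom.eq_of_eqOn_dense hgen ?_
    rintro _ ⟨p, rfl⟩
    rw [AddMonoidHom.comp_apply, hψ, map_sub, hφ, hφ, AddMonoidHom.id_apply]
    exact sub_sub_sub_cancel_right _ _ _
  exact ⟨AddMonoidHom.toAddEquiv φ ψ h1 h2⟩

end SandpileGroup

end OfEnds

/-! ### Thick cycles. -/

section ThickCycle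

variable {k : ℕ} [NeZero k]

theorem eq_of_apply_add_one_eq {X : Type*} {g : Fin k → X} (hg : ∀ i, g (i + 1) = g i)
    (i j : Fin k) : g i = g j := by
  obtain ⟨n, rfl⟩ := Nat.exists_eq_succ_of_ne_zero (NeZero.ne k)
  have key : ∀ i, g i = g 0 := by
    intro i
    induction i using Fin.induction with
    | zero => rfl
    | succ i ih => rw [← Fin.coeSucc_eq_succ, ← ih]; exact hg _
  rw [key i, key j]

/-- Partial sums give a potential; the zero total is what makes it close up at the last index. -/
theorem exists_apply_add_one_sub_eq {M : Type*} [AddCommGroup M] (f : Fin k → M)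
    (hf : ∑ i, f i = 0) : ∃ h : Fin k → M, ∀ i, h (i + 1) - h i = f i := by
  obtain ⟨n, rfl⟩ := Nat.exists_eq_succ_of_ne_zero (NeZero.ne k)
  refine ⟨fun u => ∑ j, if j < u then f j else 0, fun i => ?_⟩
  have hi : f i = ∑ j, if j = i then f j else 0 := by simp
  rw [← Finset.sum_sub_distrib]
  rcases Fin.eq_castSucc_or_eq_last i with ⟨i, rfl⟩ | rfl
  · rw [hi]
    refine Finset.sum_congr rfl fun j _ => ?_
    rw [Fin.coeSucc_eq_succ]
    rcases lt_trichotomy j i.castSucc with h | h | h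
    · simp [h, h.ne, h.trans Fin.castSucc_lt_succ]
    · simp [h]
    · simp [h.not_gt, h.ne', not_lt.2 (Fin.castSucc_lt_iff_succ_le.1 h)]
  · rw [hi, ← sub_eq_zero, ← Finset.sum_sub_distrib, ← neg_eq_zero, ← Finset.sum_neg_distrib, ← hf]
    refine Finset.sum_congr rfl fun j _ => ?_
    rcases (Fin.le_last j).lt_or_eq with h | h
    · simp [h, h.ne]
    · simp [h]

theorem sum_incidence_thickCycle {M : Type*} [AddCommGroup M] (s : Fin k → ℕ) (h : Fin k → M)
    (x : Fin k) :
    ∑ e : Σ i : Fin k, Fin (s i), incidence (fun e : Σ i : Fin k, Fin (s i) => e.1)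
        (fun e => e.1 + 1) e x • (h e.1 - h (e.1 + 1)) =
      s x • (h x - h (x + 1)) - s (x - 1) • (h (x - 1) - h x) := by
  classical
  have h1 : ∀ i : Fin k, i + 1 = x ↔ i = x - 1 := fun i => eq_sub_iff_add_eq.symm
  rw [Fintype.sum_sigma]
  simp [incidence, sub_smul, smul_sub, Finset.sum_sub_distrib, h1]
  abel

/-- The sandpile group of a thick cycle, with any distinguished vertex, is `ProportionalGroup s`. -/
theorem nonempty_sandpileGroup_thickCycle_addEquiv (s : Fin k → ℕ) (w : V(thickCycle s)) :
    Nonempty (SandpileGroup (thickCycle s) w ≃+ ProportionalGroup s) := by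
  set c : Fin k → SandpileGroup (thickCycle s) w := SandpileGroup.vertexClass
    (l := fun e : Σ i : Fin k, Fin (s i) => e.1) (r := fun e => e.1 + 1) w with hcdef
  have hc := SandpileGroup.isHarmonic_vertexClass
    (l := fun e : Σ i : Fin k, Fin (s i) => e.1) (r := fun e => e.1 + 1) w
  obtain ⟨h, hh⟩ := exists_apply_add_one_sub_eq (ProportionalGroup.gen s)
    (ProportionalGroup.sum_gen s)
  obtain ⟨ψ, hψ⟩ := ProportionalGroup.exists_lift (s := s) (fun i => c (i + 1) - c i)
    (s 0 • (c (0 + 1) - c 0))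
    (fun i => eq_of_apply_add_one_eq (g := fun i => s i • (c (i + 1) - c i)) (fun i => by
      have h1 := (sum_incidence_thickCycle s c (i + 1)).symm.trans (hc (i + 1))
      rw [add_sub_cancel_right] at h1
      rw [← neg_sub (c (i + 1)) (c (i + 1 + 1)), ← neg_sub (c i), smul_neg, smul_neg,
        sub_eq_zero.1 h1]) i 0)
    (by rw [Finset.sum_sub_distrib, sub_eq_zero]
        exact Equiv.sum_comp (Equiv.addRight (1 : Fin k)) c)
  refine SandpileGroup.nonempty_addEquiv (l := fun e : Σ i : Fin k, Fin (s i) => e.1)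
    (r := fun e => e.1 + 1) w h ?_ ?_ ψ ?_
  · intro x
    refine (sum_incidence_thickCycle s h x).trans ?_
    have h1 := hh (x - 1)
    rw [sub_add_cancel] at h1
    rw [← neg_sub (h (x + 1)), hh, ← neg_sub (h x), h1, smul_neg, smul_neg, ProportionalGroup.smul_gen s x (x - 1),
      sub_self]
  · refine eq_top_iff.2 ?_
    rw [← ProportionalGroup.closure_range_gen s]
    refine AddSubgroup.closure_mono ?_
    rintro _ ⟨i, rfl⟩
    exact ⟨(i + 1, i), hh i⟩
  · intro x y
    have h1 := eq_of_apply_add_one_eq (g := fun i => ψ (h i) - c i) (fun i => by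
      rw [sub_eq_sub_iff_sub_eq_sub, ← map_sub, hh, hψ]) x y
    exact (map_sub ψ _ _).trans (sub_eq_sub_iff_sub_eq_sub.1 h1)

end ThickCycle

/-! ### Subdivided banana graphs. -/

section Banana

variable {k : ℕ} {s : Fin k → ℕ}

theorem bananaNode_zero (l : Fin k) : bananaNode s l 0 = Sum.inl false :=
  dif_pos rfl

theorem bananaNode_self {l : Fin k} (hl : 1 ≤ s l) : bananaNode s l (s l) = Sum.inl true := by
  rw [bananaNode, dif_neg (by omega), dif_neg (lt_irrefl _)]

theorem bananaNode_add_one {l : Fin k} (i : Fin (s l - 1)) :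
    bananaNode s l (i + 1) = Sum.inr ⟨l, i⟩ := by
  rw [bananaNode, dif_neg (by omega), dif_pos (by omega)]
  simp

theorem bananaNode_eq_false_iff {l : Fin k} {j : ℕ} :
    bananaNode s l j = Sum.inl false ↔ j = 0 := by
  unfold bananaNode
  split_ifs <;> simp_all

theorem bananaNode_eq_bananaNode_iff {l l' : Fin k} {j j' : ℕ} (hj : j < s l) (hj0 : j ≠ 0) :
    bananaNode s l' j' = bananaNode s l j ↔ l' = l ∧ j' = j := by
  constructor
  · intro h
    obtain ⟨i, rfl⟩ := Nat.exists_eq_succ_of_ne_zero hj0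
    have hi : i < s l - 1 := by omega
    rw [bananaNode_add_one ⟨i, hi⟩] at h
    unfold bananaNode at h
    split_ifs at h with h1 h2
    · rw [Sum.inr.injEq, Sigma.mk.injEq] at h
      obtain ⟨rfl, h⟩ := h
      have := congrArg Fin.val (eq_of_heq h)
      simp only at this
      omega
  · rintro ⟨rfl, rfl⟩
    rfl

theorem exists_eq_bananaNode [NeZero k] (hs : ∀ l, 1 ≤ s l) (x : BananaVertex s) :
    ∃ l, ∃ j ≤ s l, x = bananaNode s l j := by
  rcases x with (_ | _) | ⟨l, i⟩
  · exact ⟨0, 0, Nat.zero_le _, (bananaNode_zero 0).symm⟩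
  · exact ⟨0, s 0, le_rfl, (bananaNode_self (hs 0)).symm⟩
  · exact ⟨l, i + 1, by omega, (bananaNode_add_one i).symm⟩

variable (s) in
/-- The left end of an edge of the subdivided banana graph. -/
abbrev bananaLeft (e : Σ l : Fin k, Fin (s l)) : BananaVertex s :=
  bananaNode s e.1 e.2

variable (s) in
/-- The right end of an edge of the subdivided banana graph. -/
abbrev bananaRight (e : Σ l : Fin k, Fin (s l)) : BananaVertex s :=
  bananaNode s e.1 (e.2 + 1)

open Classical in
theorem sum_incidence_banana {M : Type*} [AddCommGroup M] (h : BananaVertex s → M)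
    (x : BananaVertex s) :
    ∑ e, incidence (bananaLeft s) (bananaRight s) e x • (h (bananaLeft s e) - h (bananaRight s e)) =
      ∑ l, ∑ j ∈ Finset.range (s l), ((if bananaNode s l j = x then (1 : ℤ) else 0) -
        (if bananaNode s l (j + 1) = x then 1 else 0)) •
          (h (bananaNode s l j) - h (bananaNode s l (j + 1))) := by
  rw [Fintype.sum_sigma]
  refine Finset.sum_congr rfl fun l _ => ?_
  rw [← Fin.sum_univ_eq_sum_range (fun j => ((if bananaNode s l j = x then (1 : ℤ) else 0) -
        (if bananaNode s l (j + 1) = x then 1 else 0)) •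
          (h (bananaNode s l j) - h (bananaNode s l (j + 1))))]
  refine Finset.sum_congr rfl fun j _ => ?_
  simp only [incidence]
  congr

theorem IsHarmonic.sum_banana_eq_zero {M : Type*} [AddCommGroup M] {c : BananaVertex s → M}
    (hs : ∀ l, 1 ≤ s l) (hc : IsHarmonic (bananaLeft s) (bananaRight s) c) :
    ∑ l, (c (bananaNode s l 1) - c (bananaNode s l 0)) = 0 := by
  have h := hc (Sum.inl false)
  rw [sum_incidence_banana] at h
  simp only [bananaNode_eq_false_iff, Nat.add_one_ne_zero, if_false, sub_zero, ite_smul, one_smul,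
    zero_smul, Finset.sum_ite_eq', Finset.mem_range] at h
  rw [← neg_eq_zero, ← Finset.sum_neg_distrib, ← h]
  refine Finset.sum_congr rfl fun l _ => ?_
  rw [if_pos (Nat.lt_of_succ_le (hs l)), neg_sub]

theorem IsHarmonic.banana_step {M : Type*} [AddCommGroup M] {c : BananaVertex s → M}
    (hc : IsHarmonic (bananaLeft s) (bananaRight s) c) {l : Fin k} {j : ℕ} (hj : j + 1 < s l) :
    c (bananaNode s l (j + 2)) - c (bananaNode s l (j + 1)) =
      c (bananaNode s l (j + 1)) - c (bananaNode s l j) := by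
  have h := hc (bananaNode s l (j + 1))
  rw [sum_incidence_banana] at h
  simp only [bananaNode_eq_bananaNode_iff hj (Nat.succ_ne_zero j)] at h
  rw [Finset.sum_eq_single l (fun l' _ hl' => by simp [hl']) (by simp)] at h
  simp only [true_and, sub_smul, Finset.sum_sub_distrib, ite_smul, one_smul, zero_smul,
    Finset.sum_ite_eq', Finset.mem_range, Nat.add_right_cancel_iff, if_pos hj,
    if_pos (Nat.lt_of_succ_lt hj)] at h
  rw [← neg_sub, ← sub_eq_zero, ← neg_eq_zero, ← h]
  abel

theorem IsHarmonic.apply_bananaNode {M : Type*} [AddCommGroup M] {c : BananaVertex s → M}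
    (hc : IsHarmonic (bananaLeft s) (bananaRight s) c) {l : Fin k} {j : ℕ} (hj : j ≤ s l) :
    c (bananaNode s l j) = c (Sum.inl false) + j • (c (bananaNode s l 1) - c (bananaNode s l 0)) := by
  have hstep : ∀ j, j < s l → c (bananaNode s l (j + 1)) - c (bananaNode s l j) =
      c (bananaNode s l 1) - c (bananaNode s l 0) := by
    intro j
    induction j with
    | zero => intro _; rfl
    | succ j ih => intro hj; rw [hc.banana_step hj, ih (by omega)]
  induction j with
  | zero => rw [bananaNode_zero, zero_smul, add_zero]
  | succ j ih =>
    rw [succ_nsmul, ← add_assoc, ← ih (by omega), ← hstep j (by omega)]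
    abel

/-- The sandpile group of a subdivided banana graph, with any distinguished vertex, is
`ProportionalGroup s`. -/
theorem nonempty_sandpileGroup_subdividedBanana_addEquiv [NeZero k] (hs : ∀ l, 1 ≤ s l)
    (v : V(subdividedBanana s)) :
    Nonempty (SandpileGroup (subdividedBanana s) v ≃+ ProportionalGroup s) := by
  classical
  set c : BananaVertex s → SandpileGroup (subdividedBanana s) v :=
    SandpileGroup.vertexClass (l := bananaLeft s) (r := bananaRight s) v with hcdef
  have hc : IsHarmonic (bananaLeft s) (bananaRight s) c :=
    SandpileGroup.isHarmonic_vertexClass (l := bananaLeft s) (r := bananaRight s) v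
  obtain ⟨ψ, hψ⟩ := ProportionalGroup.exists_lift (s := s)
    (fun l => c (bananaNode s l 1) - c (bananaNode s l 0))
    (c (Sum.inl true) - c (Sum.inl false))
    (fun l => by rw [← bananaNode_self (hs l), hc.apply_bananaNode le_rfl, add_sub_cancel_left])
    (hc.sum_banana_eq_zero hs)
  let h : BananaVertex s → ProportionalGroup s := fun x =>
    match x with
    | Sum.inl false => 0
    | Sum.inl true => s 0 • ProportionalGroup.gen s 0
    | Sum.inr ⟨l, i⟩ => ((i : ℕ) + 1) • ProportionalGroup.gen s l
  have hh : ∀ l, ∀ j ≤ s l, h (bananaNode s l j) = j • ProportionalGroup.gen s l := by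
    intro l j hj
    rcases Nat.eq_zero_or_pos j with rfl | hj0
    · rw [bananaNode_zero, zero_smul]
    · rcases hj.lt_or_eq with hlt | rfl
      · obtain ⟨i, rfl⟩ := Nat.exists_eq_succ_of_ne_zero hj0.ne'
        have hi : i < s l - 1 := by omega
        rw [bananaNode_add_one ⟨i, hi⟩]
      · rw [bananaNode_self hj0]
        exact ProportionalGroup.smul_gen s 0 l
  refine SandpileGroup.nonempty_addEquiv (l := bananaLeft s) (r := bananaRight s) v h ?_ ?_ ψ ?_
  · intro x
    rw [sum_incidence_banana]
    -- The increment of `h` is constant along path `l`, so the incidences telescope to a coefficient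
    -- that depends only on the poles, not on `l`. Summing over `l` then uses `sum_gen`.
    have h1 : ∀ l, ∑ j ∈ Finset.range (s l), ((if bananaNode s l j = x then (1 : ℤ) else 0) -
        (if bananaNode s l (j + 1) = x then 1 else 0)) •
          (h (bananaNode s l j) - h (bananaNode s l (j + 1))) =
        ((if Sum.inl false = x then (1 : ℤ) else 0) - (if Sum.inl true = x then 1 else 0)) •
          (-ProportionalGroup.gen s l) := by
      intro l
      rw [← bananaNode_zero l, ← bananaNode_self (hs l),
        ← Finset.sum_range_sub' (fun j => if bananaNode s l j = x then (1 : ℤ) else 0),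
        Finset.sum_smul]
      refine Finset.sum_congr rfl fun j hj => ?_
      have hj := Finset.mem_range.1 hj
      rw [hh l j hj.le, hh l (j + 1) hj, succ_nsmul]
      congr 1
      abel
    simp only [h1]
    rw [← Finset.smul_sum, Finset.sum_neg_distrib, ProportionalGroup.sum_gen, neg_zero, smul_zero]
  · refine eq_top_iff.2 ?_
    rw [← ProportionalGroup.closure_range_gen s]
    refine AddSubgroup.closure_mono ?_
    rintro _ ⟨l, rfl⟩
    refine ⟨(bananaNode s l 1, bananaNode s l 0), ?_⟩
    simp only [hh l 1 (hs l), hh l 0 (Nat.zero_le _), one_smul, zero_smul, sub_zero]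
  · have h1 : ∀ x, ψ (h x) = c x - c (Sum.inl false) := by
      intro x
      obtain ⟨l, j, hj, rfl⟩ := exists_eq_bananaNode hs x
      rw [hh l j hj, map_nsmul, hψ, hc.apply_bananaNode hj, add_sub_cancel_left]
    intro x y
    refine (map_sub ψ _ _).trans ?_
    rw [h1, h1]
    exact sub_sub_sub_cancel_right _ _ _

end Banana

/-! ### Valuations of the gcds of products. -/

section GcdProd

variable {k : ℕ}

theorem gcdProd_dvd (s : Fin k → ℕ) {t : ℕ} {I : Finset (Fin k)} (hI : I.card = t) :
    gcdProd s t ∣ ∏ i ∈ I, s i :=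
  Finset.gcd_dvd (Finset.mem_powersetCard.2 ⟨Finset.subset_univ I, hI⟩)

theorem dvd_gcdProd {s : Fin k → ℕ} {t a : ℕ}
    (h : ∀ I : Finset (Fin k), I.card = t → a ∣ ∏ i ∈ I, s i) : a ∣ gcdProd s t :=
  Finset.dvd_gcd fun I hI => h I (Finset.mem_powersetCard.1 hI).2

theorem gcdProd_zero (s : Fin k → ℕ) : gcdProd s 0 = 1 :=
  Nat.dvd_one.1 (gcdProd_dvd s Finset.card_empty)

theorem gcdProd_dvd_gcdProd_succ (s : Fin k → ℕ) (t : ℕ) : gcdProd s t ∣ gcdProd s (t + 1) := by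
  refine dvd_gcdProd fun I hI => ?_
  obtain ⟨i, hi⟩ := Finset.card_pos.1 (hI.symm ▸ Nat.succ_pos t : 0 < I.card)
  rw [← Finset.mul_prod_erase I s hi]
  exact (gcdProd_dvd s (by rw [Finset.card_erase_of_mem hi, hI, Nat.add_sub_cancel])).mul_left _

theorem gcdProd_pos {s : Fin k → ℕ} (hs : ∀ i, 1 ≤ s i) {t : ℕ} (ht : t ≤ k) :
    0 < gcdProd s t := by
  obtain ⟨I, -, hI⟩ := Finset.exists_subset_card_eq
    (ht.trans_eq (Finset.card_fin k).symm)
  exact Nat.pos_of_dvd_of_pos (gcdProd_dvd s hI) (Finset.prod_pos fun i _ => hs i)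

theorem gcdProd_dvd_prod (s : Fin k → ℕ) {t : ℕ} (ht : t ≤ k) : gcdProd s t ∣ ∏ i, s i := by
  obtain ⟨I, hIu, hI⟩ := Finset.exists_subset_card_eq
    (ht.trans_eq (Finset.card_fin k).symm)
  exact (gcdProd_dvd s hI).trans (Finset.prod_dvd_prod_of_subset _ _ _ hIu)

theorem gcdProd_comp_perm (s : Fin k → ℕ) (σ : Equiv.Perm (Fin k)) (t : ℕ) :
    gcdProd (s ∘ σ) t = gcdProd s t := by
  have key : ∀ (s : Fin k → ℕ) (σ : Equiv.Perm (Fin k)), gcdProd s t ∣ gcdProd (s ∘ σ) t := by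
    intro s σ
    refine dvd_gcdProd fun I hI => ?_
    have h := gcdProd_dvd s (I := I.map σ.toEmbedding) ((Finset.card_map _).trans hI)
    rwa [Finset.prod_map] at h
  refine Nat.dvd_antisymm ?_ (key s σ)
  have h := key (s ∘ σ) σ.symm
  rwa [Function.comp_assoc, Equiv.self_comp_symm, Function.comp_id] at h

theorem gcdProd_dvd_sum_prod_erase (n : ℕ) (s : Fin (n + 2) → ℕ) :
    gcdProd s n ∣ ∑ i, ∏ j ∈ Finset.univ.erase i, s j := by
  refine (gcdProd_dvd_gcdProd_succ s n).trans (Finset.dvd_sum fun i _ => gcdProd_dvd s ?_)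
  rw [Finset.card_erase_of_mem (Finset.mem_univ i), Finset.card_fin]
  rfl

theorem sum_castLE_le_sum {f : Fin k → ℕ} (hf : Monotone f) {t : ℕ} (ht : t ≤ k)
    {I : Finset (Fin k)} (hI : I.card = t) :
    ∑ i : Fin t, f (Fin.castLE ht i) ≤ ∑ i ∈ I, f i := by
  have hle : ∀ m (hm : m < t), m ≤ (I.orderEmbOfFin hI ⟨m, hm⟩).val := by
    intro m
    induction m with
    | zero => intro _; exact Nat.zero_le _
    | succ m ih =>
      intro hm
      have h1 : I.orderEmbOfFin hI ⟨m, by omega⟩ < I.orderEmbOfFin hI ⟨m + 1, hm⟩ :=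
        (I.orderEmbOfFin hI).strictMono (Fin.mk_lt_mk.2 (Nat.lt_succ_self m))
      exact (ih (by omega)).trans_lt h1
  conv_rhs => rw [← Finset.map_orderEmbOfFin_univ I hI, Finset.sum_map]
  exact Finset.sum_le_sum fun i _ => hf (hle i i.2)

/-- The valuation of a gcd is the least valuation, attained here by the first `t` factors since the
valuations increase. -/
theorem factorization_gcdProd {p : ℕ} (hp : p.Prime) {s : Fin k → ℕ} (hs : ∀ i, 1 ≤ s i)
    (hmono : Monotone fun i => (s i).factorization p) {t : ℕ} (ht : t ≤ k) :
    (gcdProd s t).factorization p = ∑ i : Fin t, (s (Fin.castLE ht i)).factorization p := by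
  have hs0 : ∀ i, s i ≠ 0 := fun i => Nat.one_le_iff_ne_zero.1 (hs i)
  have hfac : ∀ I : Finset (Fin k),
      (∏ i ∈ I, s i).factorization p = ∑ i ∈ I, (s i).factorization p := fun I => by
    rw [Nat.factorization_prod fun i _ => hs0 i, Finsupp.finsetSum_apply]
  apply le_antisymm
  · have h := gcdProd_dvd s (I := Finset.univ.map (Fin.castLEEmb ht))
      ((Finset.card_map _).trans (Finset.card_fin t))
    have h2 := (Nat.factorization_le_iff_dvd (gcdProd_pos hs ht).ne'
      (Finset.prod_ne_zero_iff.2 fun i _ => hs0 i)).2 h p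
    rw [hfac, Finset.sum_map] at h2
    exact h2
  · rw [← hp.pow_dvd_iff_le_factorization (gcdProd_pos hs ht).ne']
    refine dvd_gcdProd fun I hI => ?_
    rw [hp.pow_dvd_iff_le_factorization (Finset.prod_ne_zero_iff.2 fun i _ => hs0 i), hfac]
    exact sum_castLE_le_sum hmono ht hI

theorem factorization_gcdProd_div {p : ℕ} (hp : p.Prime) {s : Fin k → ℕ} (hs : ∀ i, 1 ≤ s i)
    (hmono : Monotone fun i => (s i).factorization p) {t : ℕ} (ht : t < k) :
    (gcdProd s (t + 1) / gcdProd s t).factorization p = (s ⟨t, ht⟩).factorization p := by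
  rw [Nat.factorization_div (gcdProd_dvd_gcdProd_succ s t), Finsupp.tsub_apply,
    factorization_gcdProd hp hs hmono ht, factorization_gcdProd hp hs hmono ht.le,
    Fin.sum_univ_castSucc]
  exact Nat.add_sub_cancel_left _ _

/-- The factor `ordCompl[p] P` absorbs the part of `x` prime to `p`, so divisibility need only be
checked at `p`. -/
theorem dvd_ordCompl_mul {p : ℕ} (hp : p.Prime) {x y P : ℕ} (hx : x ∣ P) (hy : y ≠ 0)
    (h : x.factorization p ≤ y.factorization p) : x ∣ ordCompl[p] P * y := by
  rw [← Nat.ordProj_mul_ordCompl_eq_self x p, mul_comm]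
  exact mul_dvd_mul (Nat.ordCompl_dvd_ordCompl_of_dvd hx p)
    ((hp.pow_dvd_iff_le_factorization hy).2 h)

end GcdProd

/-! ### The decomposition into cyclic groups. -/

section Cyclic

/-- A product of `n + 1` cyclic groups receives, up to a factor `u * u`, a surjection from the
group `ProportionalGroup r` with `n + 2` generators. -/
theorem exists_proportional_tuple {n : ℕ} (r : Fin (n + 2) → ℕ) (d : Fin n → ℕ) (m u : ℕ)
    (q : Fin (n + 1) → ℕ) (hd : ∀ t, d t ∣ u * r t.castSucc.castSucc)
    (hdlast : ∀ t, d t ∣ u * r (Fin.last (n + 1)))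
    (hq : ∀ j, q j * r j.castSucc = u * r (Fin.last n).castSucc) (hqlast : q (Fin.last n) = u)
    (hm : m ∣ u * r (Fin.last n).castSucc + r (Fin.last (n + 1)) * ∑ j, q j) :
    ∃ (F : Fin (n + 2) → ((t : Fin n) → ZMod (d t)) × ZMod m)
      (x : ((t : Fin n) → ZMod (d t)) × ZMod m),
      (∀ i, r i • F i = x) ∧ ∑ i, F i = 0 ∧
        ∀ b, (u * u) • b ∈ AddSubgroup.closure (Set.range F) := by
  set G : Fin (n + 1) → ((t : Fin n) → ZMod (d t)) × ZMod m :=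
    fun j => (fun t => if j = t.castSucc then (u : ZMod (d t)) else 0, (q j : ZMod m)) with hG
  set L : ((t : Fin n) → ZMod (d t)) × ZMod m :=
    (fun t => -(u : ZMod (d t)), -((∑ j, q j : ℕ) : ZMod m)) with hL
  refine ⟨Fin.snoc (α := fun _ => ((t : Fin n) → ZMod (d t)) × ZMod m) G L,
    (0, ((u * r (Fin.last n).castSucc : ℕ) : ZMod m)), ?_, ?_, ?_⟩
  · intro i
    refine Fin.lastCases ?_ (fun j => ?_) i
    · rw [Fin.snoc_last]
      refine Prod.ext (funext fun t => ?_) ?_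
      · change r (Fin.last (n + 1)) • -(u : ZMod (d t)) = 0
        rw [smul_neg, neg_eq_zero, nsmul_eq_mul, ← Nat.cast_mul, mul_comm,
          ZMod.natCast_eq_zero_iff]
        exact hdlast t
      · change r (Fin.last (n + 1)) • -((∑ j, q j : ℕ) : ZMod m) = _
        rw [smul_neg, eq_comm, ← sub_eq_zero, sub_neg_eq_add, nsmul_eq_mul, ← Nat.cast_mul,
          ← Nat.cast_add, ZMod.natCast_eq_zero_iff]
        exact hm
    · rw [Fin.snoc_castSucc]
      refine Prod.ext (funext fun t => ?_) ?_
      · change r j.castSucc • (if j = t.castSucc then (u : ZMod (d t)) else 0) = 0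
        split_ifs with hj
        · rw [hj, nsmul_eq_mul, ← Nat.cast_mul, mul_comm, ZMod.natCast_eq_zero_iff]
          exact hd t
        · exact smul_zero _
      · change r j.castSucc • (q j : ZMod m) = _
        rw [nsmul_eq_mul, ← Nat.cast_mul, mul_comm, hq]
  · rw [Fin.sum_univ_castSucc]
    simp only [Fin.snoc_castSucc, Fin.snoc_last]
    refine Prod.ext (funext fun t => ?_) ?_
    · simp [hG, hL, Prod.fst_sum]
    · simp [hG, hL, Prod.snd_sum]
  · intro b
    have hmem : ∀ j, G j ∈ AddSubgroup.closure (Set.range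
        (Fin.snoc (α := fun _ => ((t : Fin n) → ZMod (d t)) × ZMod m) G L)) := fun j =>
      AddSubgroup.subset_closure ⟨j.castSucc, Fin.snoc_castSucc _ _ _⟩
    choose c hc using fun t => ZMod.intCast_surjective (b.1 t)
    obtain ⟨c', hc'⟩ := ZMod.intCast_surjective b.2
    -- The first `n` coordinates fix the multiples of `G t.castSucc`; the multiple of `G (Fin.last
    -- n)`, which is `(0, u)`, then corrects the last coordinate.
    have hb : (u * u) • b = ∑ t : Fin n, (u * c t) • G t.castSucc +
        (u * c' - ∑ t : Fin n, c t * q t.castSucc) • G (Fin.last n) := by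
      refine Prod.ext (funext fun t => ?_) ?_
      · have h0 : ∀ t : Fin n, Fin.last n ≠ t.castSucc := fun t => (Fin.castSucc_lt_last t).ne'
        simp [hG, Prod.fst_sum, h0, ← hc t]
        ring
      · simp only [Prod.snd_add, Prod.snd_sum, Prod.smul_snd, ← hc']
        simp only [hG, hqlast, nsmul_eq_mul, zsmul_eq_mul]
        push_cast
        rw [sub_mul, Finset.sum_mul, add_sub_left_comm, ← Finset.sum_sub_distrib]
        rw [Finset.sum_eq_zero fun t _ => by ring]
        ring
    rw [hb]
    exact AddSubgroup.add_mem _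
      (AddSubgroup.sum_mem _ fun t _ => AddSubgroup.zsmul_mem _ (hmem _) _)
      (AddSubgroup.zsmul_mem _ (hmem _) _)

theorem exists_proportional_tuple_of_monotone {n p : ℕ} (hp : p.Prime) {r : Fin (n + 2) → ℕ}
    (hr : ∀ i, 1 ≤ r i) (hmono : Monotone fun i => (r i).factorization p) :
    ∃ (F : Fin (n + 2) → ((t : Fin n) → ZMod (gcdProd r (t + 1) / gcdProd r t)) ×
        ZMod ((∑ i, ∏ j ∈ Finset.univ.erase i, r j) / gcdProd r n))
      (x : ((t : Fin n) → ZMod (gcdProd r (t + 1) / gcdProd r t)) ×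
        ZMod ((∑ i, ∏ j ∈ Finset.univ.erase i, r j) / gcdProd r n)) (u : ℕ), p.Coprime u ∧
      (∀ i, r i • F i = x) ∧ ∑ i, F i = 0 ∧ ∀ b, u • b ∈ AddSubgroup.closure (Set.range F) := by
  have hr0 : ∀ i, r i ≠ 0 := fun i => Nat.one_le_iff_ne_zero.1 (hr i)
  set P := ∏ i, r i with hP
  have hP0 : P ≠ 0 := Finset.prod_ne_zero_iff.2 fun i _ => hr0 i
  set u := ordCompl[p] P with hu
  have hcop : p.Coprime u := Nat.coprime_ordCompl hp hP0
  have hd : ∀ (t : Fin n) (j : Fin (n + 2)), t.castSucc.castSucc ≤ j →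
      gcdProd r (t + 1) / gcdProd r t ∣ u * r j := by
    intro t j htj
    have ht : (t : ℕ) < n + 2 := by omega
    refine dvd_ordCompl_mul hp ?_ (hr0 j) ?_
    · exact (Nat.div_dvd_of_dvd (gcdProd_dvd_gcdProd_succ r t)).trans (gcdProd_dvd_prod r ht)
    · rw [factorization_gcdProd_div hp hr hmono ht]
      exact hmono htj
  have hq : ∀ j : Fin (n + 1), r j.castSucc ∣ u * r (Fin.last n).castSucc := fun j =>
    dvd_ordCompl_mul hp (Finset.dvd_prod_of_mem r (Finset.mem_univ _)) (hr0 _)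
      (hmono (Fin.castSucc_le_castSucc_iff.2 (Fin.le_last j)))
  choose q hq using hq
  have hqlast : q (Fin.last n) = u :=
    (Nat.eq_of_mul_eq_mul_left (hr (Fin.last n).castSucc) ((mul_comm _ _).trans (hq _))).symm
  set Q := ∏ t : Fin n, r t.castSucc.castSucc with hQ
  have hQ0 : Q ≠ 0 := Finset.prod_ne_zero_iff.2 fun i _ => hr0 _
  have hPQ : P = Q * r (Fin.last n).castSucc * r (Fin.last (n + 1)) := by
    rw [hP, Fin.prod_univ_castSucc, Fin.prod_univ_castSucc]
  have hQdvd : Q ∣ u * gcdProd r n := by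
    refine dvd_ordCompl_mul hp ?_ (gcdProd_pos hr (by omega)).ne' ?_
    · rw [hPQ, mul_assoc]
      exact dvd_mul_right _ _
    · rw [factorization_gcdProd hp hr hmono (by omega : n ≤ n + 2), hQ,
        Nat.factorization_prod fun i _ => hr0 _, Finsupp.finsetSum_apply]
      exact le_rfl
  set N := ∑ i, ∏ j ∈ Finset.univ.erase i, r j with hN
  -- Term by term: each summand on the left is `u` times a product omitting one factor, as `q j`
  -- stands for `u * r n / r j`.
  have hkey : Q * (u * r (Fin.last n).castSucc + r (Fin.last (n + 1)) * ∑ j, q j) = u * N := by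
    have herase : ∀ i, r i * ∏ j ∈ Finset.univ.erase i, r j = P := fun i =>
      Finset.mul_prod_erase _ r (Finset.mem_univ i)
    rw [hN, Fin.sum_univ_castSucc (fun i => ∏ j ∈ Finset.univ.erase i, r j), mul_add, mul_add,
      add_comm, Finset.mul_sum, Finset.mul_sum,
      Finset.mul_sum]
    congr 1
    · refine Finset.sum_congr rfl fun j _ => ?_
      refine Nat.eq_of_mul_eq_mul_left (hr j.castSucc) ?_
      calc r j.castSucc * (Q * (r (Fin.last (n + 1)) * q j))
          = Q * r (Fin.last (n + 1)) * (r j.castSucc * q j) := by ring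
        _ = u * (r j.castSucc * ∏ i ∈ Finset.univ.erase j.castSucc, r i) := by
          rw [← hq, herase, hPQ]; ring
        _ = _ := by ring
    · refine Nat.eq_of_mul_eq_mul_left (hr (Fin.last (n + 1))) ?_
      calc r (Fin.last (n + 1)) * (Q * (u * r (Fin.last n).castSucc))
          = u * (r (Fin.last (n + 1)) * ∏ i ∈ Finset.univ.erase (Fin.last (n + 1)), r i) := by
            rw [herase, hPQ]; ring
        _ = _ := by ring
  have hm : N / gcdProd r n ∣
      u * r (Fin.last n).castSucc + r (Fin.last (n + 1)) * ∑ j, q j := by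
    obtain ⟨c, hc⟩ := hQdvd
    refine ⟨c, Nat.eq_of_mul_eq_mul_left (Nat.pos_of_ne_zero hQ0) ?_⟩
    have h1 : gcdProd r n * (N / gcdProd r n) = N :=
      Nat.mul_div_cancel' (gcdProd_dvd_sum_prod_erase n r)
    calc Q * (u * r (Fin.last n).castSucc + r (Fin.last (n + 1)) * ∑ j, q j)
        = (u * gcdProd r n) * (N / gcdProd r n) := by rw [hkey, mul_assoc, h1]
      _ = Q * (N / gcdProd r n * c) := by rw [hc]; ring
  obtain ⟨F, x, h1, h2, h3⟩ := exists_proportional_tuple r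
    (fun t : Fin n => gcdProd r (t + 1) / gcdProd r t) (N / gcdProd r n) u q
    (fun t => hd t _ le_rfl) (fun t => hd t _ (Fin.le_last _))
    (fun j => (mul_comm _ _).trans (hq j).symm) hqlast hm
  exact ⟨F, x, u * u, hcop.mul_right hcop, h1, h2, h3⟩

theorem prod_gcdProd_div {k : ℕ} (s : Fin k → ℕ) (n : ℕ) :
    ∏ t : Fin n, gcdProd s (t + 1) / gcdProd s t = gcdProd s n := by
  induction n with
  | zero => rw [Fin.prod_univ_zero, gcdProd_zero]
  | succ n ih =>
    rw [Fin.prod_univ_castSucc]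
    simp only [Fin.val_castSucc, Fin.val_last]
    rw [ih, Nat.mul_div_cancel' (gcdProd_dvd_gcdProd_succ s n)]

theorem ProportionalGroup.nonempty_addEquiv_pi_zmod (n : ℕ) (s : Fin (n + 2) → ℕ)
    (hs : ∀ i, 1 ≤ s i) :
    Nonempty (ProportionalGroup s ≃+
      ((t : Fin n) → ZMod (gcdProd s (t + 1) / gcdProd s t)) ×
        ZMod ((∑ i, ∏ j ∈ Finset.univ.erase i, s j) / gcdProd s n)) := by
  have hpos : 0 < ∑ i, ∏ j ∈ Finset.univ.erase i, s j :=
    Finset.sum_pos (fun i _ => Finset.prod_pos fun j _ => hs j) Finset.univ_nonempty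
  have hcardB : Nat.card (((t : Fin n) → ZMod (gcdProd s (t + 1) / gcdProd s t)) ×
      ZMod ((∑ i, ∏ j ∈ Finset.univ.erase i, s j) / gcdProd s n)) =
      ∑ i, ∏ j ∈ Finset.univ.erase i, s j := by
    rw [Nat.card_prod, Nat.card_pi, Nat.card_zmod]
    simp only [Nat.card_zmod]
    rw [prod_gcdProd_div, Nat.mul_div_cancel' (gcdProd_dvd_sum_prod_erase n s)]
  have := Nat.finite_of_card_ne_zero (hcardB.trans_ne hpos.ne')
  have := Nat.finite_of_card_ne_zero ((ProportionalGroup.natCard s hs).trans_ne hpos.ne')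
  refine nonempty_addEquiv_of_forall_prime ((ProportionalGroup.natCard s hs).trans hcardB.symm)
    fun p hp => ?_
  -- The sorting depends on `p`, but the gcds and the order are symmetric in `s`, so the target
  -- group does not.
  set σ := Tuple.sort fun i => (s i).factorization p
  have hmono : Monotone fun i => ((s ∘ σ) i).factorization p :=
    Tuple.monotone_sort fun i => (s i).factorization p
  have hN : ∑ i, ∏ j ∈ Finset.univ.erase i, (s ∘ σ) j =
      ∑ i, ∏ j ∈ Finset.univ.erase i, s j := by
    conv_rhs => rw [← Equiv.sum_comp σ]
    refine Finset.sum_congr rfl fun i _ => ?_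
    refine Finset.prod_equiv σ (fun j => ?_) (fun j _ => rfl)
    simp
  have h := exists_proportional_tuple_of_monotone (r := s ∘ σ) hp (fun i => hs (σ i)) hmono
  rw [show gcdProd (s ∘ σ) = gcdProd s from funext (gcdProd_comp_perm s σ), hN] at h
  obtain ⟨F, x, u, hu, hx, hF, hspan⟩ := h
  obtain ⟨φ, hφ⟩ := ProportionalGroup.exists_lift (s := s) (F ∘ σ.symm) x
    (fun i => by simpa using hx (σ.symm i))
    ((Equiv.sum_comp σ.symm F).trans hF)
  refine ⟨φ, u, hu, fun b => ?_⟩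
  refine (AddSubgroup.closure_le φ.range).2 ?_ (hspan b)
  rintro _ ⟨i, rfl⟩
  exact ⟨ProportionalGroup.gen s (σ i), by rw [hφ]; simp⟩

end Cyclic

end Sandpile

theorem mainTheorem3 (k : ℕ) [NeZero k] (s : Fin k → ℕ) (hs : ∀ l, 1 ≤ s l)
    (v : V(Sandpile.subdividedBanana s)) (w : V(Sandpile.thickCycle s)) :
    Nonempty (Sandpile.SandpileGroup (Sandpile.subdividedBanana s) v ≃+
      Sandpile.SandpileGroup (Sandpile.thickCycle s) w) ∧
    Nat.card (Sandpile.SandpileGroup (Sandpile.thickCycle s) w) =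
      ∑ i, ∏ j ∈ Finset.univ.erase i, s j ∧
    (2 ≤ k →
      Nonempty (Sandpile.SandpileGroup (Sandpile.subdividedBanana s) v ≃+
        ((t : Fin (k - 2)) → ZMod (Sandpile.gcdProd s (t + 1) / Sandpile.gcdProd s t)) ×
          ZMod (Nat.card (Sandpile.SandpileGroup (Sandpile.thickCycle s) w) /
            Sandpile.gcdProd s (k - 2)))) := by
  obtain ⟨eB⟩ := Sandpile.nonempty_sandpileGroup_subdividedBanana_addEquiv hs v
  obtain ⟨eC⟩ := Sandpile.nonempty_sandpileGroup_thickCycle_addEquiv s w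
  have hcard := (Nat.card_congr eC.toEquiv).trans (Sandpile.ProportionalGroup.natCard s hs)
  refine ⟨⟨eB.trans eC.symm⟩, hcard, fun hk => ?_⟩
  rw [hcard]
  clear hcard eC w
  obtain ⟨n, rfl⟩ := Nat.exists_eq_add_of_le' hk
  obtain ⟨e⟩ := Sandpile.ProportionalGroup.nonempty_addEquiv_pi_zmod n s hs
  exact ⟨eB.trans e⟩
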